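/- A triple $(V,T,U)$ consists of a finite-dimensional complex vector space $V$, a linear operator $T$ on $V$, and a subspace $U\subseteq V$ with $T(U)\subseteq U$. Put $n_V=\dim\ker T$ and $n_U=\dim\ker(T|_U)$. The operator $T$ is nilpotent of order $p\ge 1$ if $T^p=0$ and $T^{p-1}\neq 0$. The triple is indecomposable if, for all $T$-invariant subspaces $V',V''$ with $V=V'\oplus V''$ and $U=(U\cap V')\oplus(U\cap V'')$, one has $V'=\{0\}$ or $V''=\{0\}$. Two triples $(V,T,U)$ and $(V',T',U')$ are similar if there is an invertible linear map $f:V\to V'$ with $fT=T'f$ and $f(U)=U'$. Let $p\ge 1$. The number of similarity classes of indecomposable triples $(V,T,U)$ with $T$ nilpotent of order $p$, $n_V=3$ and $n_U=2$ is infinite if and only if $p\ge 6$. Moreover, if $p\ge 6$, there is a family of such triples indexed by $\mathbb{C}$ whose members are pairwise non-similar. -/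

import Mathlib

universe u

/-- A triple `(V, T, U)`: a finite dimensional complex vector space `V`, a linear operator `T`
on `V`, and a `T`-invariant subspace `U` of `V`. -/
structure InvTriple : Type (u + 1) where
  V : Type u
  [instAddCommGroup : AddCommGroup V]
  [instModule : Module ℂ V]
  [instFinite : FiniteDimensional ℂ V]
  T : Module.End ℂ V
  U : Submodule ℂ V
  invariant : ∀ x ∈ U, T x ∈ U

namespace InvTriple

attribute [instance] instAddCommGroup instModule instFinite

/-- `T` is nilpotent of order `p ≥ 1`: `T ^ p = 0` and `T ^ (p - 1) ≠ 0`. -/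
def HasOrder (X : InvTriple.{u}) (p : ℕ) : Prop :=
  1 ≤ p ∧ X.T ^ p = 0 ∧ X.T ^ (p - 1) ≠ 0

/-- `n_V = dim [V]`, where `[V] = ker T`. -/
noncomputable def nV (X : InvTriple.{u}) : ℕ :=
  Module.finrank ℂ (LinearMap.ker X.T)

/-- `n_U = dim [U]`, where `[U] = ker (T restricted to U)`. -/
noncomputable def nU (X : InvTriple.{u}) : ℕ :=
  Module.finrank ℂ (LinearMap.ker (X.T.restrict X.invariant))

/-- `(V, T, U)` is indecomposable: whenever `V = V' ⊕ V''` with `V'`, `V''` invariant under `T` and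
`U = (U ∩ V') ⊕ (U ∩ V'')`, one of `V'`, `V''` is zero. (The second sum is automatically direct
once the first one is.) -/
def Indecomposable (X : InvTriple.{u}) : Prop :=
  ∀ V' V'' : Submodule ℂ X.V, (∀ x ∈ V', X.T x ∈ V') → (∀ x ∈ V'', X.T x ∈ V'') →
    IsCompl V' V'' → X.U = (X.U ⊓ V') ⊔ (X.U ⊓ V'') → V' = ⊥ ∨ V'' = ⊥

/-- Two triples are similar if there is an invertible linear map `f : V → V'` with `f T = T' f`
and `f(U) = U'`. -/
def Similar (X Y : InvTriple.{u}) : Prop :=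
  ∃ f : X.V ≃ₗ[ℂ] Y.V, (∀ x, f (X.T x) = Y.T (f x)) ∧
    X.U.map (f : X.V →ₗ[ℂ] Y.V) = Y.U

theorem Similar.refl (X : InvTriple.{u}) : Similar X X :=
  ⟨LinearEquiv.refl ℂ X.V, fun _ => rfl, by ext x; simp⟩

theorem Similar.symm {X Y : InvTriple.{u}} (h : Similar X Y) : Similar Y X := by
  obtain ⟨f, hT, hU⟩ := h
  refine ⟨f.symm, fun y => ?_, ?_⟩
  · apply f.injective
    simp [hT]
  · rw [← hU]
    ext x
    simp [Submodule.mem_map]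

theorem Similar.trans {X Y Z : InvTriple.{u}} (h : Similar X Y) (k : Similar Y Z) :
    Similar X Z := by
  obtain ⟨f, hT, hU⟩ := h
  obtain ⟨g, kT, kU⟩ := k
  refine ⟨f.trans g, fun x => by simp [hT, kT], ?_⟩
  rw [← kU, ← hU]
  ext z
  simp [Submodule.mem_map]

/-- Similarity as an equivalence relation on triples. -/
def similarSetoid : Setoid InvTriple.{u} where
  r := Similar
  iseqv := ⟨Similar.refl, Similar.symm, Similar.trans⟩

/-- The similarity classes of indecomposable triples `(V, T, U)` with `T` nilpotent of order `p`,
`n_V = m` and `n_U = k`. -/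
def indecClasses (p m k : ℕ) : Set (Quotient similarSetoid.{u}) :=
  {c | ∃ X : InvTriple.{u}, Quotient.mk similarSetoid X = c ∧
    X.HasOrder p ∧ X.nV = m ∧ X.nU = k ∧ X.Indecomposable}

end InvTriple

/-!
A nilpotent operator `T` on `V` makes `V` a module over the discrete valuation ring `ℂ⟦X⟧`, with `X`
acting as `T`, and `V ≃ ⨁ i, ℂ⟦X⟧ / (X ^ a i)`, with one summand for each dimension of `ker T`. For
`n_V = 3` and `n_U = 2`, a triple is thus given by the exponents `a 0, a 1, a 2` and by a `3 × 2`
matrix over `ℂ⟦X⟧`, whose columns `x`, `y` generate `U` (`HasColumns`, `exists_hasColumns`). Similarity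
allows all invertible column operations, multiplication of rows by units, and subtracting `c` times
row `j` from row `i` as soon as `X ^ a i` divides `c * X ^ a j`.

*Finiteness for `p ≤ 5`.* Three numbers in `{1, …, 5}` either contain a `1`, or two of them differ by
at most `1`. In both cases the operations produce two zeros in the matrix such that the remaining
entries, seen as edges between rows and columns, form a forest; then the units in the entries can be
scaled away, and the matrix consists of zeros and powers of `X`
(`HasColumns.monomial_of_gap`, `HasColumns.monomial_of_eq_one`). That leaves finitely many matrices,
decomposable triples included.

*The family for `p ≥ 6`.* Take `a = (p, 4, 2)`, `x = (X ^ 2, X, 1)` and `y = (0, X ^ 2, z X)` with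
`z : ℂ`. Here all three gaps `p - 4`, `4 - 2` and `2` are at least `2`, so the matrix of a morphism
from the member `z` to the member `z'` is triangular modulo `X`, and comparing lowest coefficients
shows that its diagonal is a scalar `c` with `c * (z - z') = 0` (`family_matrix`). A morphism with
`c ≠ 0` is surjective by Nakayama's lemma, and one with `c = 0` kills the socle of the largest Jordan
block (`HasColumns.exists_eigenvalue`). Hence similar members have equal parameters, and for a
decomposition of a member one of the two projections is the identity.
-/

namespace InvTriple

open PowerSeries

universe v w

/-! ### Presentations of nilpotent operators by power series -/

section Presentations

variable {ι : Type*} {V : Type v} [AddCommGroup V] [Module ℂ V]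

/-- The submodule `⨁ i, (X ^ a i)` of the free module `ι → ℂ⟦X⟧`. -/
noncomputable def relations (a : ι → ℕ) : Submodule ℂ⟦X⟧ (ι → ℂ⟦X⟧) :=
  Submodule.pi Set.univ fun i => Ideal.span {X ^ a i}

theorem mem_relations {a : ι → ℕ} {f : ι → ℂ⟦X⟧} :
    f ∈ relations a ↔ ∀ i, X ^ a i ∣ f i := by
  simp [relations, Submodule.mem_pi, Ideal.mem_span_singleton]

/-- `Φ` presents `(V, T)` as `⨁ i, ℂ⟦X⟧ / (X ^ a i)`, with `X` acting as `T`. -/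
structure IsPresentation (Φ : (ι → ℂ⟦X⟧) →ₗ[ℂ] V) (T : Module.End ℂ V) (a : ι → ℕ) : Prop where
  surjective : Function.Surjective Φ
  map_X_smul : ∀ f, Φ ((X : ℂ⟦X⟧) • f) = T (Φ f)
  map_eq_zero : ∀ f, Φ f = 0 ↔ f ∈ relations a

namespace IsPresentation

variable {Φ : (ι → ℂ⟦X⟧) →ₗ[ℂ] V} {T : Module.End ℂ V} {a : ι → ℕ}

theorem map_eq_iff (h : IsPresentation Φ T a) {f g : ι → ℂ⟦X⟧} :
    Φ f = Φ g ↔ ∀ i, X ^ a i ∣ f i - g i := by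
  rw [← sub_eq_zero, ← map_sub, h.map_eq_zero, mem_relations]
  rfl

theorem map_X_pow_smul (h : IsPresentation Φ T a) (n : ℕ) (f : ι → ℂ⟦X⟧) :
    Φ ((X : ℂ⟦X⟧) ^ n • f) = (T ^ n) (Φ f) := by
  induction n generalizing f with
  | zero => simp
  | succ n ih => rw [pow_succ, mul_smul, ih, h.map_X_smul, pow_succ]; rfl

/-- If all parts `a i` are positive, then the vectors `X ^ (a i - 1) e i` form a basis of the
kernel of `T`. -/
theorem finrank_ker [Fintype ι] (h : IsPresentation Φ T a) (ha : ∀ i, 1 ≤ a i) :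
    Module.finrank ℂ (LinearMap.ker T) = Fintype.card ι := by
  let ψ : (ι → ℂ) →ₗ[ℂ] V := Φ ∘ₗ
    { toFun := fun c i => X ^ (a i - 1) * C (c i)
      map_add' := fun c d => by ext i; simp [mul_add]
      map_smul' := fun r c => by
        funext i
        simp [PowerSeries.smul_eq_C_mul, mul_left_comm] }
  have hψ : ∀ c, ψ c = Φ fun i => X ^ (a i - 1) * C (c i) := fun c => rfl
  have hinj : Function.Injective ψ := by
    rw [← LinearMap.ker_eq_bot, LinearMap.ker_eq_bot']
    intro c hc
    rw [hψ, h.map_eq_zero, mem_relations] at hc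
    funext i
    have := (X_pow_dvd_iff.1 (hc i)) (a i - 1) (by have := ha i; omega)
    simpa using this
  have hrange : LinearMap.range ψ = LinearMap.ker T := by
    ext v
    rw [LinearMap.mem_range, LinearMap.mem_ker]
    constructor
    · rintro ⟨c, rfl⟩
      rw [hψ, ← h.map_X_smul, h.map_eq_zero, mem_relations]
      intro i
      refine ⟨C (c i), ?_⟩
      rw [Pi.smul_apply, smul_eq_mul, ← mul_assoc, ← pow_succ', Nat.sub_add_cancel (ha i)]
    · intro hv
      obtain ⟨f, rfl⟩ := h.surjective v
      rw [← h.map_X_smul, h.map_eq_zero, mem_relations] at hv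
      have hd : ∀ i, ∃ g, f i = X ^ (a i - 1) * g := by
        intro i
        have h1 := hv i
        rw [Pi.smul_apply, smul_eq_mul, ← Nat.sub_add_cancel (ha i), pow_succ'] at h1
        exact (mul_dvd_mul_iff_left X_ne_zero).1 h1
      choose g hg using hd
      refine ⟨fun i => constantCoeff (g i), ?_⟩
      rw [hψ, h.map_eq_iff]
      intro i
      have : (X : ℂ⟦X⟧) ∣ C (constantCoeff (g i)) - g i := by
        rw [X_dvd_iff]; simp
      obtain ⟨q, hq⟩ := this
      refine ⟨q, ?_⟩
      rw [hg, ← mul_sub, hq, ← mul_assoc, ← pow_succ, Nat.sub_add_cancel (ha i)]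
  rw [← hrange, LinearMap.finrank_range_of_inj hinj, Module.finrank_fintype_fun_eq_card]

end IsPresentation

/-- A linear map from a free `ℂ⟦X⟧`-module that turns multiplication by `X` into a nilpotent
operator is determined by its values on the standard basis: `f = ∑ f i (0) e i + X g` reduces the
claim to `X g`, and so on, and finally to `X ^ n g`, which is sent to `0`. -/
theorem linearMap_ext_of_nilpotent [Finite ι] [DecidableEq ι] {T : Module.End ℂ V} {n : ℕ}
    (hT : T ^ n = 0)
    {Φ Ψ : (ι → ℂ⟦X⟧) →ₗ[ℂ] V} (hΦ : ∀ f, Φ ((X : ℂ⟦X⟧) • f) = T (Φ f))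
    (hΨ : ∀ f, Ψ ((X : ℂ⟦X⟧) • f) = T (Ψ f))
    (h : ∀ i, Φ (Pi.single i 1) = Ψ (Pi.single i 1)) : Φ = Ψ := by
  cases nonempty_fintype ι
  have key : ∀ k f, ∃ g, Φ f - Ψ f = (T ^ k) (Φ g - Ψ g) := by
    intro k
    induction k with
    | zero => exact fun f => ⟨f, rfl⟩
    | succ k ih =>
      intro f
      obtain ⟨g, hg⟩ := ih f
      have hd : ∀ i, ∃ q, g i = X * q + C (constantCoeff (g i)) :=
        fun i => ⟨_, eq_X_mul_shift_add_const (g i)⟩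
      choose q hq using hd
      have hgq : g = (X : ℂ⟦X⟧) • q +
          ∑ i, constantCoeff (g i) • (Pi.single i 1 : ι → ℂ⟦X⟧) := by
        funext j
        rw [Pi.add_apply, Finset.sum_apply, Finset.sum_eq_single j, hq j]
        · simp [PowerSeries.smul_eq_C_mul]
        · intro i _ hij
          simp [Pi.single_eq_of_ne hij.symm]
        · simp
      refine ⟨q, ?_⟩
      have : Φ g - Ψ g = T (Φ q - Ψ q) := by
        rw [hgq]
        simp only [map_add, map_sum, map_smul, hΦ, hΨ, h, map_sub]
        abel
      rw [hg, this, pow_succ]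
      rfl
  refine LinearMap.ext fun f => ?_
  obtain ⟨g, hg⟩ := key n f
  rw [hT] at hg
  exact sub_eq_zero.1 hg

end Presentations

/-! ### Existence of presentations -/

section Existence

variable {ι : Type*} {V : Type v} [AddCommGroup V] [Module ℂ V]

namespace IsPresentation

variable {Φ : (ι → ℂ⟦X⟧) →ₗ[ℂ] V} {T : Module.End ℂ V} {a : ι → ℕ}

theorem reindex {κ : Type*} (h : IsPresentation Φ T a) (σ : ι ≃ κ) :
    IsPresentation (Φ ∘ₗ LinearMap.funLeft ℂ ℂ⟦X⟧ σ) T (a ∘ σ.symm) where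
  surjective := h.surjective.comp (LinearMap.funLeft_surjective_of_injective _ _ _ σ.injective)
  map_X_smul f := h.map_X_smul _
  map_eq_zero f := by
    rw [LinearMap.comp_apply, h.map_eq_zero, mem_relations, mem_relations, ← σ.forall_congr_right]
    simp [LinearMap.funLeft]

theorem restrict_support (h : IsPresentation Φ T a) :
    ∃ Ψ : ({i // a i ≠ 0} → ℂ⟦X⟧) →ₗ[ℂ] V, IsPresentation Ψ T fun i => a i := by
  classical
  let ext : ({i // a i ≠ 0} → ℂ⟦X⟧) →ₗ[ℂ] (ι → ℂ⟦X⟧) :=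
    LinearMap.pi fun i => if hi : a i ≠ 0 then LinearMap.proj ⟨i, hi⟩ else 0
  have hin : ∀ g i (hi : a i ≠ 0), ext g i = g ⟨i, hi⟩ := fun g i hi => by simp [ext, hi]
  have hout : ∀ g i, a i = 0 → ext g i = 0 := fun g i hi => by simp [ext, hi]
  refine ⟨Φ ∘ₗ ext, fun v => ?_, fun f => ?_, fun f => ?_⟩
  · obtain ⟨f, rfl⟩ := h.surjective v
    refine ⟨fun i => f i, ?_⟩
    rw [LinearMap.comp_apply, h.map_eq_iff]
    intro i
    by_cases hi : a i = 0
    · simp [hi]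
    · rw [hin _ i hi, sub_self]
      exact dvd_zero _
  · rw [LinearMap.comp_apply, LinearMap.comp_apply, ← h.map_X_smul]
    congr 1
    funext i
    by_cases hi : a i = 0
    · simp [hout _ i hi]
    · simp [hin _ i hi]
  · rw [LinearMap.comp_apply, h.map_eq_zero, mem_relations, mem_relations]
    refine ⟨fun H i => by simpa only [hin _ _ i.2] using H i, fun H i => ?_⟩
    by_cases hi : a i = 0
    · simp [hi]
    · rw [hin _ i hi]
      exact H ⟨i, hi⟩

theorem le_of_pow_eq_zero [DecidableEq ι] (h : IsPresentation Φ T a) {n : ℕ} (hT : T ^ n = 0)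
    (i : ι) : a i ≤ n := by
  have h1 := h.map_X_pow_smul n (Pi.single i 1)
  rw [hT, LinearMap.zero_apply, h.map_eq_zero, mem_relations] at h1
  have h2 := h1 i
  simp only [Pi.smul_apply, Pi.single_eq_same, smul_eq_mul, mul_one] at h2
  exact (pow_dvd_pow_iff X_ne_zero X_prime.not_isUnit).1 h2

end IsPresentation

/-- The structure theorem for finitely generated torsion modules over `ℂ[X]`, with coefficients
extended from `ℂ[X]` to `ℂ⟦X⟧` by truncation; some of the `a i` may vanish. -/
theorem exists_presentation_fin [FiniteDimensional ℂ V] (T : Module.End ℂ V) {n : ℕ}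
    (hT : T ^ n = 0) :
    ∃ (d : ℕ) (a : Fin d → ℕ) (Φ : (Fin d → ℂ⟦X⟧) →ₗ[ℂ] V), IsPresentation Φ T a := by
  classical
  have htors : Module.IsTorsion' (Module.AEval' T)
      (Submonoid.powers (Polynomial.X : Polynomial ℂ)) := by
    rw [Submodule.isTorsion'_powers_iff]
    intro x
    refine ⟨n, ?_⟩
    obtain ⟨y, rfl⟩ := (Module.AEval'.of T).surjective x
    rw [Module.AEval'.X_pow_smul_of, hT, zero_smul, map_zero]
  obtain ⟨d, k, ⟨E⟩⟩ := Module.torsion_by_prime_power_decomposition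
    (Polynomial.irreducible_X (R := ℂ)) htors
  let q : (Fin d → Polynomial ℂ) →ₗ[Polynomial ℂ] Module.AEval' T :=
    (E.symm.toLinearMap ∘ₗ (DirectSum.linearEquivFunOnFintype (Polynomial ℂ) (Fin d)
      (fun i => Polynomial ℂ ⧸ Submodule.span (Polynomial ℂ)
        {(Polynomial.X : Polynomial ℂ) ^ k i})).symm.toLinearMap) ∘ₗ
      LinearMap.pi fun i => (Submodule.mkQ _) ∘ₗ LinearMap.proj i
  have hq0 : ∀ g, q g = 0 ↔ ∀ i, Polynomial.X ^ k i ∣ g i := by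
    intro g
    simp only [q, LinearMap.comp_apply, LinearEquiv.coe_coe, LinearEquiv.map_eq_zero_iff]
    rw [funext_iff]
    refine forall_congr' fun i => ?_
    exact (Submodule.Quotient.mk_eq_zero _).trans Ideal.mem_span_singleton
  have hqs : Function.Surjective q := by
    refine (E.symm.surjective.comp (LinearEquiv.surjective _)).comp fun v => ?_
    choose g hg using fun i => Submodule.mkQ_surjective _ (v i)
    exact ⟨g, funext hg⟩
  have hqX : ∀ g, q ((Polynomial.X : Polynomial ℂ) ^ n • g) = 0 := by
    intro g
    rw [map_smul]
    obtain ⟨y, hy⟩ := (Module.AEval'.of T).surjective (q g)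
    rw [← hy, Module.AEval'.X_pow_smul_of, hT, zero_smul, map_zero]
  have hk : ∀ i, k i ≤ n := by
    intro i
    have h2 := (hq0 _).1 (hqX (Pi.single i 1)) i
    simp only [Pi.smul_apply, Pi.single_eq_same, smul_eq_mul, mul_one] at h2
    exact (pow_dvd_pow_iff Polynomial.X_ne_zero Polynomial.prime_X.not_isUnit).1 h2
  let τ : (Fin d → ℂ⟦X⟧) →ₗ[ℂ] (Fin d → Polynomial ℂ) :=
    LinearMap.pi fun i => trunc n ∘ₗ LinearMap.proj i
  have hτ : ∀ f i, τ f i = trunc n (f i) := fun f i => rfl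
  let Φ : (Fin d → ℂ⟦X⟧) →ₗ[ℂ] V :=
    (Module.AEval'.of T).symm.toLinearMap ∘ₗ q.restrictScalars ℂ ∘ₗ τ
  have hΦ : ∀ f, Φ f = (Module.AEval'.of T).symm (q (τ f)) := fun f => rfl
  refine ⟨d, k, Φ, fun v => ?_, fun f => ?_, fun f => ?_⟩
  · obtain ⟨g, hg⟩ := hqs (Module.AEval'.of T v)
    refine ⟨fun i => (g i : ℂ⟦X⟧), ?_⟩
    rw [hΦ, LinearEquiv.symm_apply_eq, ← hg, ← sub_eq_zero, ← map_sub, hq0]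
    intro i
    rw [Polynomial.X_pow_dvd_iff]
    intro m hm
    rw [Pi.sub_apply, hτ, Polynomial.coeff_sub, coeff_trunc, if_pos (hm.trans_le (hk i)),
      Polynomial.coeff_coe, sub_self]
  · rw [hΦ, hΦ, LinearEquiv.symm_apply_eq, ← Module.AEval'.X_smul_of,
      LinearEquiv.apply_symm_apply, ← map_smul, ← sub_eq_zero, ← map_sub, hq0]
    intro i
    rw [Polynomial.X_pow_dvd_iff]
    intro m hm
    rw [Pi.sub_apply, Pi.smul_apply, hτ, hτ, Polynomial.coeff_sub, coeff_trunc,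
      if_pos (hm.trans_le (hk i)), Pi.smul_apply, smul_eq_mul, smul_eq_mul]
    cases m with
    | zero => simp
    | succ m =>
      rw [coeff_succ_X_mul, Polynomial.coeff_X_mul, coeff_trunc,
        if_pos (by have := hk i; omega), sub_self]
  · rw [hΦ, LinearEquiv.map_eq_zero_iff, hq0, mem_relations]
    refine forall_congr' fun i => ?_
    rw [Polynomial.X_pow_dvd_iff, X_pow_dvd_iff]
    refine forall₂_congr fun m hm => ?_
    rw [hτ, coeff_trunc, if_pos (hm.trans_le (hk i))]

/-- Jordan normal form of a nilpotent operator, as a presentation with one part for each dimension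
of the kernel. -/
theorem exists_presentation [FiniteDimensional ℂ V] (T : Module.End ℂ V) {n : ℕ}
    (hT : T ^ n = 0) {d : ℕ} (hd : Module.finrank ℂ (LinearMap.ker T) = d) :
    ∃ (a : Fin d → ℕ) (Φ : (Fin d → ℂ⟦X⟧) →ₗ[ℂ] V), IsPresentation Φ T a ∧ ∀ i, 1 ≤ a i := by
  obtain ⟨d', a, Φ, h⟩ := exists_presentation_fin T hT
  obtain ⟨Ψ, h'⟩ := h.restrict_support
  have hpos : ∀ i : {i // a i ≠ 0}, 1 ≤ a i := fun i => Nat.one_le_iff_ne_zero.2 i.2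
  have hcard := h'.finrank_ker hpos
  rw [hd] at hcard
  exact ⟨_, _, h'.reindex (Fintype.equivFinOfCardEq hcard.symm), fun i => hpos _⟩

end Existence

/-! ### Generators of the invariant subspace, and row and column operations -/

section Columns

/-- The triple `A` has a presentation `V = ⨁ i, ℂ⟦X⟧ / (X ^ a i)` in which `U` is the submodule
generated by the classes of the two columns `x` and `y`. -/
def HasColumns {ι : Type*} (A : InvTriple.{u}) (a : ι → ℕ) (x y : ι → ℂ⟦X⟧) : Prop :=
  ∃ Φ : (ι → ℂ⟦X⟧) →ₗ[ℂ] A.V, IsPresentation Φ A.T a ∧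
    ∀ v, v ∈ A.U ↔ ∃ α β : ℂ⟦X⟧, Φ (α • x + β • y) = v

variable {ι : Type*} {A B : InvTriple.{u}} {a : ι → ℕ} {x y x' y' : ι → ℂ⟦X⟧}

theorem HasColumns.similar (hA : HasColumns A a x y) (hB : HasColumns B a x y) :
    Similar A B := by
  obtain ⟨Φ, hΦ, hU⟩ := hA
  obtain ⟨Ψ, hΨ, hU'⟩ := hB
  have hker : LinearMap.ker Φ = LinearMap.ker Ψ := by
    ext f
    rw [LinearMap.mem_ker, LinearMap.mem_ker, hΦ.map_eq_zero, hΨ.map_eq_zero]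
  let E : A.V ≃ₗ[ℂ] B.V := (Φ.quotKerEquivOfSurjective hΦ.surjective).symm ≪≫ₗ
    Submodule.quotEquivOfEq _ _ hker ≪≫ₗ Ψ.quotKerEquivOfSurjective hΨ.surjective
  have hE : ∀ f, E (Φ f) = Ψ f := by
    intro f
    have : (Φ.quotKerEquivOfSurjective hΦ.surjective).symm (Φ f) = Submodule.Quotient.mk f := by
      rw [LinearEquiv.symm_apply_eq]; rfl
    simp only [E, LinearEquiv.trans_apply, this]
    rfl
  refine ⟨E, fun v => ?_, ?_⟩
  · obtain ⟨f, rfl⟩ := hΦ.surjective v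
    rw [← hΦ.map_X_smul, hE, hE, hΨ.map_X_smul]
  · ext w
    rw [hU', Submodule.mem_map]
    constructor
    · rintro ⟨v, hv, rfl⟩
      obtain ⟨α, β, rfl⟩ := (hU v).1 hv
      exact ⟨α, β, (hE _).symm⟩
    · rintro ⟨α, β, rfl⟩
      exact ⟨_, (hU _).2 ⟨α, β, rfl⟩, hE _⟩

/-- Only the classes of the columns modulo the relations matter, and they may be replaced by any
other generators of the same submodule. -/
theorem HasColumns.of_generators (h : HasColumns A a x y) {p q r s p' q' r' s' : ℂ⟦X⟧}
    (hx : ∀ i, X ^ a i ∣ p * x' i + q * y' i - x i)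
    (hy : ∀ i, X ^ a i ∣ r * x' i + s * y' i - y i)
    (hx' : ∀ i, X ^ a i ∣ p' * x i + q' * y i - x' i)
    (hy' : ∀ i, X ^ a i ∣ r' * x i + s' * y i - y' i) : HasColumns A a x' y' := by
  obtain ⟨Φ, hΦ, hU⟩ := h
  have key : ∀ {x y x' y' : ι → ℂ⟦X⟧} {p q r s : ℂ⟦X⟧} (α β : ℂ⟦X⟧),
      (∀ i, X ^ a i ∣ p * x' i + q * y' i - x i) →
      (∀ i, X ^ a i ∣ r * x' i + s * y' i - y i) →
      Φ ((α * p + β * r) • x' + (α * q + β * s) • y') = Φ (α • x + β • y) := by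
    intro x y x' y' p q r s α β hx hy
    rw [hΦ.map_eq_iff]
    intro i
    convert dvd_add ((hx i).mul_left α) ((hy i).mul_left β) using 1
    simp only [Pi.add_apply, Pi.smul_apply, smul_eq_mul]
    ring
  refine ⟨Φ, hΦ, fun v => ?_⟩
  rw [hU]
  constructor
  · rintro ⟨α, β, rfl⟩
    exact ⟨_, _, key α β hx hy⟩
  · rintro ⟨α, β, rfl⟩
    exact ⟨_, _, key α β hx' hy'⟩

theorem HasColumns.congr (h : HasColumns A a x y) (hx : ∀ i, X ^ a i ∣ x' i - x i)
    (hy : ∀ i, X ^ a i ∣ y' i - y i) : HasColumns A a x' y' := by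
  refine h.of_generators (p := 1) (q := 0) (r := 0) (s := 1) (p' := 1) (q' := 0) (r' := 0)
    (s' := 1) (fun i => by simpa using hx i) (fun i => by simpa using hy i)
    (fun i => ?_) (fun i => ?_)
  · simpa [dvd_sub_comm] using hx i
  · simpa [dvd_sub_comm] using hy i

theorem HasColumns.swap (h : HasColumns A a x y) : HasColumns A a y x := by
  refine h.of_generators (p := 0) (q := 1) (r := 1) (s := 0) (p' := 0) (q' := 1) (r' := 1)
    (s' := 0) ?_ ?_ ?_ ?_ <;> simp

theorem HasColumns.sub_smul (h : HasColumns A a x y) (c : ℂ⟦X⟧) :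
    HasColumns A a x (fun i => y i - c * x i) := by
  refine h.of_generators (p := 1) (q := 0) (r := c) (s := 1) (p' := 1) (q' := 0) (r' := -c)
    (s' := 1) ?_ ?_ ?_ ?_ <;> intro i <;> ring_nf <;> simp

theorem HasColumns.unit_smul (h : HasColumns A a x y) {u : ℂ⟦X⟧} (hu : IsUnit u) :
    HasColumns A a x (fun i => u * y i) := by
  obtain ⟨w, hw⟩ := hu.exists_left_inv
  refine h.of_generators (p := 1) (q := 0) (r := 0) (s := w) (p' := 1) (q' := 0) (r' := 0)
    (s' := u) ?_ ?_ ?_ ?_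
  · simp
  · intro i
    rw [← mul_assoc w, hw]
    simp
  · simp
  · intro i
    rw [zero_mul, zero_add, sub_self]
    exact dvd_zero _

theorem HasColumns.map (h : HasColumns A a x y) (g : (ι → ℂ⟦X⟧) ≃ₗ[ℂ⟦X⟧] (ι → ℂ⟦X⟧))
    (hg : ∀ f, g f ∈ relations a ↔ f ∈ relations a) : HasColumns A a (g x) (g y) := by
  obtain ⟨Φ, hΦ, hU⟩ := h
  refine ⟨Φ ∘ₗ g.symm.toLinearMap.restrictScalars ℂ, ⟨?_, fun f => ?_, fun f => ?_⟩, fun v => ?_⟩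
  · exact hΦ.surjective.comp g.symm.surjective
  · simp [hΦ.map_X_smul]
  · rw [LinearMap.comp_apply, hΦ.map_eq_zero, ← hg]
    simp
  · simp [hU]

/-- Rescaling the basis vectors of a presentation by units. -/
theorem HasColumns.scale_rows (h : HasColumns A a x y) {u : ι → ℂ⟦X⟧} (hu : ∀ i, IsUnit (u i)) :
    HasColumns A a (fun i => u i * x i) (fun i => u i * y i) := by
  choose w hw using fun i => (hu i).exists_left_inv
  have hw' : ∀ i, u i * w i = 1 := fun i => by rw [mul_comm, hw]
  refine h.map
    { toFun := fun f i => u i * f i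
      invFun := fun f i => w i * f i
      map_add' := fun f g => by funext i; exact mul_add _ _ _
      map_smul' := fun c f => by funext i; exact mul_left_comm _ _ _
      left_inv := fun f => by funext i; simp [← mul_assoc, hw]
      right_inv := fun f => by funext i; simp [← mul_assoc, hw'] } fun f => ?_
  rw [mem_relations, mem_relations]
  exact forall_congr' fun i => (hu i).dvd_mul_left

/-- Subtracting `c` times row `j` from row `i`: this is the effect on coordinates of a change of
basis, and it respects the relations if `X ^ a i` divides `c * X ^ a j`. -/
theorem HasColumns.sub_row [DecidableEq ι] (h : HasColumns A a x y) {i j : ι} (hij : i ≠ j)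
    {c : ℂ⟦X⟧} (hc : X ^ a i ∣ c * X ^ a j) :
    HasColumns A a (Function.update x i (x i - c * x j))
      (Function.update y i (y i - c * y j)) := by
  have key : ∀ (c : ℂ⟦X⟧) (f : ι → ℂ⟦X⟧), X ^ a i ∣ c * X ^ a j → f ∈ relations a →
      Function.update f i (f i - c * f j) ∈ relations a := by
    intro c f hc hf
    rw [mem_relations] at hf ⊢
    intro k
    rcases eq_or_ne k i with rfl | hk
    · rw [Function.update_self]
      exact dvd_sub (hf k) (hc.trans (mul_dvd_mul_left c (hf j)))
    · rw [Function.update_of_ne hk]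
      exact hf k
  have inv : ∀ (c : ℂ⟦X⟧) (f : ι → ℂ⟦X⟧),
      Function.update (Function.update f i (f i - c * f j)) i
        (Function.update f i (f i - c * f j) i
          - (-c) * Function.update f i (f i - c * f j) j) = f := by
    intro c f
    rw [Function.update_self, Function.update_of_ne hij.symm, Function.update_idem]
    convert Function.update_eq_self i f using 2
    ring
  refine h.map
    { toFun := fun f => Function.update f i (f i - c * f j)
      invFun := fun f => Function.update f i (f i - (-c) * f j)
      map_add' := fun f g => by
        funext k
        rcases eq_or_ne k i with rfl | hk
        · simp; ring
        · simp [hk]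
      map_smul' := fun r f => by
        funext k
        rcases eq_or_ne k i with rfl | hk
        · simp; ring
        · simp [hk]
      left_inv := fun f => inv c f
      right_inv := fun f => by simpa using inv (-c) f } fun f => ?_
  refine ⟨fun hf => ?_, key c f hc⟩
  have := key (-c) _ (by simpa using hc) hf
  exact (congrArg (· ∈ relations a) (inv c f)).mp this

end Columns

section Divisibility

theorem dvd_or_X_mul_dvd (f g : ℂ⟦X⟧) : f ∣ g ∨ X * g ∣ f := by
  rcases ValuationRing.dvd_total f g with h | ⟨c, rfl⟩
  · exact Or.inl h
  · by_cases hc : constantCoeff c = 0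
    · obtain ⟨d, rfl⟩ := X_dvd_iff.2 hc
      exact Or.inr ⟨d, by ring⟩
    · have hu : IsUnit c := isUnit_iff_constantCoeff.2 (isUnit_iff_ne_zero.2 hc)
      exact Or.inl (hu.mul_right_dvd.2 dvd_rfl)

/-- `f` is zero or a power of `X`. -/
def IsMonomial (f : ℂ⟦X⟧) : Prop := f = 0 ∨ ∃ k, f = X ^ k

theorem exists_unit_mul_isMonomial (f : ℂ⟦X⟧) : ∃ u, IsUnit u ∧ IsMonomial (u * f) := by
  by_cases hf : f = 0
  · exact ⟨1, isUnit_one, Or.inl (by simp [hf])⟩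
  · obtain ⟨n, u, hu⟩ := IsDiscreteValuationRing.eq_unit_mul_pow_irreducible hf X_irreducible
    exact ⟨_, u⁻¹.isUnit, Or.inr ⟨n, by rw [hu, Units.inv_mul_cancel_left]⟩⟩

/-- Modulo `X ^ n`, a zero entry can be written as the power `X ^ m`, for any `m ≥ n`. -/
theorem IsMonomial.exists_pow {f : ℂ⟦X⟧} (hf : IsMonomial f) {n m : ℕ} (hn : n ≤ m) :
    ∃ k : Fin (m + 1), (X : ℂ⟦X⟧) ^ n ∣ X ^ (k : ℕ) - f := by
  rcases hf with rfl | ⟨k, rfl⟩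
  · exact ⟨Fin.last m, by simpa using pow_dvd_pow X hn⟩
  · by_cases hk : k ≤ m
    · exact ⟨⟨k, by omega⟩, by simp⟩
    · exact ⟨Fin.last m, dvd_sub (pow_dvd_pow X hn) (pow_dvd_pow X (by omega))⟩

end Divisibility

/-! ### Finiteness for `p ≤ 5` -/

section Reduction

variable {ι : Type*} {A B : InvTriple.{u}} {a : ι → ℕ} {x y : ι → ℂ⟦X⟧}

/-- `A` has a presentation in which all coordinates of the two generators of `U` are zero or powers
of `X`. -/
def HasMonomialColumns (A : InvTriple.{u}) (a : ι → ℕ) : Prop :=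
  ∃ x y : ι → ℂ⟦X⟧, (∀ i, IsMonomial (x i)) ∧ (∀ i, IsMonomial (y i)) ∧ HasColumns A a x y

/-- If one column has at most one nonzero entry, the units of the entries can be scaled away:
the rows take care of the first column, and the second column of itself. -/
theorem HasColumns.monomial_of_single (h : HasColumns A a x y) (i : ι)
    (hy : ∀ j, j ≠ i → y j = 0) : HasMonomialColumns A a := by
  choose u hu hux using fun j => exists_unit_mul_isMonomial (x j)
  obtain ⟨v, hv, hvy⟩ := exists_unit_mul_isMonomial (u i * y i)
  refine ⟨_, _, hux, fun j => ?_, (h.scale_rows hu).unit_smul hv⟩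
  rcases eq_or_ne j i with rfl | hj
  · exact hvy
  · exact Or.inl (by rw [hy j hj, mul_zero, mul_zero])

/-- If only row `k` has two nonzero entries, the units of the entries can be scaled away. -/
theorem HasColumns.monomial_of_path [DecidableEq ι] (h : HasColumns A a x y) {i j k : ι}
    (hik : i ≠ k) (hjk : j ≠ k) (hij : i ≠ j) (hall : ∀ l, l = i ∨ l = j ∨ l = k)
    (hx : x j = 0) (hy : y i = 0) : HasMonomialColumns A a := by
  obtain ⟨r, hr, hrx⟩ := exists_unit_mul_isMonomial (x k)
  obtain ⟨v, hv, hvy⟩ := exists_unit_mul_isMonomial (r * y k)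
  obtain ⟨s, hs, hsx⟩ := exists_unit_mul_isMonomial (x i)
  obtain ⟨t, ht, hty⟩ := exists_unit_mul_isMonomial (v * y j)
  let w : ι → ℂ⟦X⟧ := fun l => if l = k then r else if l = i then s else t
  have hwk : w k = r := if_pos rfl
  have hwi : w i = s := by simp [w, hik]
  have hwj : w j = t := by simp [w, hjk, hij.symm]
  refine ⟨_, _, fun l => ?_, fun l => ?_, (h.scale_rows (u := w) fun l => ?_).unit_smul hv⟩
  · rcases hall l with rfl | rfl | rfl
    · rwa [hwi]
    · exact Or.inl (by rw [hx, mul_zero])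
    · rwa [hwk]
  · rcases hall l with rfl | rfl | rfl
    · exact Or.inl (by rw [hy, mul_zero, mul_zero])
    · rwa [hwj, mul_left_comm]
    · rwa [hwk]
  · rcases hall l with rfl | rfl | rfl
    · rwa [hwi]
    · rwa [hwj]
    · rwa [hwk]

theorem HasColumns.exists_clear (h : HasColumns A a x y) (k : ι) :
    ∃ x' y', HasColumns A a x' y' ∧ y' k = 0 := by
  rcases ValuationRing.dvd_total (x k) (y k) with ⟨c, hc⟩ | ⟨c, hc⟩
  · exact ⟨_, _, h.sub_smul c, by rw [hc]; ring⟩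
  · exact ⟨_, _, h.swap.sub_smul c, by rw [hc]; ring⟩

/-- Once column operations have cleared the entry of the second column in row `k`, the rows `i`
and `j` are close enough for a row operation to clear one of the other two entries, without
touching row `k`. -/
theorem HasColumns.monomial_of_gap [DecidableEq ι] (h : HasColumns A a x y) {i j k : ι}
    (hik : i ≠ k) (hjk : j ≠ k) (hij : i ≠ j) (hall : ∀ l, l = i ∨ l = j ∨ l = k)
    (h1 : a i ≤ a j) (h2 : a j ≤ a i + 1) : HasMonomialColumns A a := by
  obtain ⟨x, y, h, hy⟩ := h.exists_clear k
  rcases dvd_or_X_mul_dvd (y j) (y i) with ⟨c, hc⟩ | ⟨c, hc⟩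
  · refine (h.sub_row hij (c := c) ((pow_dvd_pow X h1).mul_left c)).monomial_of_single j ?_
    intro l hl
    rcases hall l with rfl | rfl | rfl
    · rw [Function.update_self, hc]; ring
    · exact absurd rfl hl
    · rw [Function.update_of_ne hik.symm, hy]
  · have hX : (X : ℂ⟦X⟧) ^ a j ∣ X * c * X ^ a i :=
      (pow_dvd_pow X h2).trans ⟨c, by ring⟩
    refine (h.sub_row hij.symm (c := X * c) hX).monomial_of_single i ?_
    intro l hl
    rcases hall l with rfl | rfl | rfl
    · exact absurd rfl hl
    · rw [Function.update_self, hc]; ring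
    · rw [Function.update_of_ne hjk.symm, hy]

/-- If row `i` is only defined modulo `X`, then adding a multiple of `X` times the first column to
the second keeps the zero in row `i`. -/
theorem HasColumns.monomial_of_eq_one [DecidableEq ι] (h : HasColumns A a x y) {i j k : ι}
    (hik : i ≠ k) (hjk : j ≠ k) (hij : i ≠ j) (hall : ∀ l, l = i ∨ l = j ∨ l = k)
    (h1 : a i = 1) : HasMonomialColumns A a := by
  obtain ⟨x, y, h, hy⟩ := h.exists_clear i
  rcases dvd_or_X_mul_dvd (y j) (x j) with ⟨c, hc⟩ | ⟨c, hc⟩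
  · exact (h.swap.sub_smul c).swap.monomial_of_path hik hjk hij hall (by rw [hc]; ring) hy
  · have h' := (h.sub_smul (X * c)).congr (x' := x)
      (y' := Function.update (fun l => y l - X * c * x l) i 0) (fun l => by simp) fun l => ?_
    · refine h'.monomial_of_single k fun l hl => ?_
      rcases hall l with rfl | rfl | rfl
      · rw [Function.update_self]
      · rw [Function.update_of_ne hij.symm, hc]; ring
      · exact absurd rfl hl
    · rcases eq_or_ne l i with rfl | hl
      · rw [Function.update_self, hy, h1]
        exact ⟨c * x l, by ring⟩
      · simp [hl]

/-- Three numbers between `2` and `5` cannot have pairwise distances at least `2`, so one of the two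
reductions applies. -/
theorem HasColumns.hasMonomialColumns {a : Fin 3 → ℕ} {x y : Fin 3 → ℂ⟦X⟧}
    (h : HasColumns A a x y) (ha : ∀ i, 1 ≤ a i) (ha' : ∀ i, a i ≤ 5) :
    HasMonomialColumns A a := by
  by_cases h1 : ∃ i, a i = 1
  · obtain ⟨i, hi⟩ := h1
    refine h.monomial_of_eq_one (i := i) (j := i + 1) (k := i + 2) ?_ ?_ ?_ ?_ hi <;>
      clear hi <;> revert i <;> decide
  · have h2 : ∃ i j k : Fin 3, (i ≠ k ∧ j ≠ k ∧ i ≠ j ∧ ∀ l, l = i ∨ l = j ∨ l = k) ∧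
        a i ≤ a j ∧ a j ≤ a i + 1 := by
      by_contra hcon
      push Not at h1 hcon
      have := h1 0
      have := h1 1
      have := h1 2
      have := ha 0
      have := ha 1
      have := ha 2
      have := ha' 0
      have := ha' 1
      have := ha' 2
      have := hcon 0 1 2 (by decide)
      have := hcon 1 0 2 (by decide)
      have := hcon 0 2 1 (by decide)
      have := hcon 2 0 1 (by decide)
      have := hcon 1 2 0 (by decide)
      have := hcon 2 1 0 (by decide)
      omega
    obtain ⟨i, j, k, ⟨hik, hjk, hij, hall⟩, h3, h4⟩ := h2
    exact h.monomial_of_gap hik hjk hij hall h3 h4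

theorem HasMonomialColumns.exists_pow {a : ι → ℕ} {m : ℕ} (h : HasMonomialColumns A a)
    (ha : ∀ i, a i ≤ m) : ∃ k l : ι → Fin (m + 1),
      HasColumns A a (fun i => X ^ (k i : ℕ)) (fun i => X ^ (l i : ℕ)) := by
  obtain ⟨x, y, hx, hy, h⟩ := h
  choose k hk using fun i => (hx i).exists_pow (ha i)
  choose l hl using fun i => (hy i).exists_pow (ha i)
  exact ⟨k, l, h.congr hk hl⟩

/-- The columns are the coordinates, in a presentation of `V`, of the two generators of `U` that come
from a presentation of `U`. -/
theorem exists_hasColumns {n d : ℕ} (hT : A.T ^ n = 0) (hV : A.nV = d) (hU : A.nU = 2) :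
    ∃ (a : Fin d → ℕ) (x y : Fin d → ℂ⟦X⟧), HasColumns A a x y ∧
      ∀ i, 1 ≤ a i ∧ a i ≤ n := by
  obtain ⟨a, Φ, hΦ, ha⟩ := exists_presentation A.T hT hV
  have hTU : (A.T.restrict A.invariant) ^ n = 0 := by
    rw [Module.End.pow_restrict n A.invariant]
    ext v
    simp [hT]
  obtain ⟨b, Ψ, hΨ, -⟩ := exists_presentation (A.T.restrict A.invariant) hTU hU
  obtain ⟨x, hx⟩ := hΦ.surjective (Ψ (Pi.single 0 1))
  obtain ⟨y, hy⟩ := hΦ.surjective (Ψ (Pi.single 1 1))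
  let g : (Fin 2 → ℂ⟦X⟧) →ₗ[ℂ⟦X⟧] (Fin d → ℂ⟦X⟧) :=
    (LinearMap.proj 0).smulRight x + (LinearMap.proj 1).smulRight y
  have hg : ∀ f, g f = f 0 • x + f 1 • y := fun f => rfl
  have key : A.U.subtype ∘ₗ Ψ = Φ ∘ₗ g.restrictScalars ℂ := by
    refine linearMap_ext_of_nilpotent hT (fun f => ?_) (fun f => ?_) fun i => ?_
    · simp [hΨ.map_X_smul]
    · simp [hΦ.map_X_smul]
    · fin_cases i <;> simp [hg, hx, hy]
  refine ⟨a, x, y, ⟨Φ, hΦ, fun v => ⟨fun hv => ?_, ?_⟩⟩, fun i => ⟨ha i, ?_⟩⟩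
  · obtain ⟨f, hf⟩ := hΨ.surjective ⟨v, hv⟩
    exact ⟨f 0, f 1, by simpa [hf, hg] using (LinearMap.congr_fun key f).symm⟩
  · rintro ⟨α, β, rfl⟩
    have := LinearMap.congr_fun key ![α, β]
    simp only [LinearMap.comp_apply, LinearMap.coe_restrictScalars, hg] at this
    exact this ▸ (Ψ ![α, β]).2
  · exact hΦ.le_of_pow_eq_zero hT i

/-- For `p ≤ 5` the triples under consideration are determined by finitely many exponents. -/
theorem finite_indecClasses {p : ℕ} (hp : p ≤ 5) : (indecClasses.{u} p 3 2).Finite := by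
  have key : ∀ c : indecClasses.{u} p 3 2, ∃ d : Fin 3 → Fin 6 × Fin 6 × Fin 6,
      ∃ A : InvTriple.{u}, Quotient.mk similarSetoid A = c ∧
        HasColumns A (fun i => ((d i).1 : ℕ)) (fun i => X ^ ((d i).2.1 : ℕ))
          (fun i => X ^ ((d i).2.2 : ℕ)) := by
    rintro ⟨_, A, rfl, hA, hV, hU, -⟩
    obtain ⟨a, x, y, h, ha⟩ := exists_hasColumns hA.2.1 hV hU
    have ha5 : ∀ i, a i ≤ 5 := fun i => (ha i).2.trans hp
    obtain ⟨k, l, h'⟩ := (h.hasMonomialColumns (fun i => (ha i).1) ha5).exists_pow ha5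
    exact ⟨fun i => (⟨a i, by have := ha5 i; omega⟩, k i, l i), A, rfl, h'⟩
  choose d A hA hd using key
  refine Set.finite_coe_iff.1 (Finite.of_injective d fun c c' hcc' => Subtype.ext ?_)
  rw [← hA c, ← hA c']
  have h := hd c'
  rw [← hcc'] at h
  exact Quotient.sound ((hd c).similar h)

end Reduction

/-! ### A one-parameter family for `p ≥ 6` -/

section Family

theorem IsPresentation.pow_eq_zero {ι : Type*} {V : Type v} [AddCommGroup V] [Module ℂ V]
    {Φ : (ι → ℂ⟦X⟧) →ₗ[ℂ] V} {T : Module.End ℂ V} {a : ι → ℕ} (h : IsPresentation Φ T a) {n : ℕ}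
    (ha : ∀ i, a i ≤ n) : T ^ n = 0 := by
  ext v
  obtain ⟨f, rfl⟩ := h.surjective v
  rw [← h.map_X_pow_smul, LinearMap.zero_apply, h.map_eq_zero, mem_relations]
  exact fun i => (pow_dvd_pow X (ha i)).mul_right _

instance finiteDimensional_quotient_relations {ι : Type*} [Finite ι] (a : ι → ℕ) :
    FiniteDimensional ℂ ((ι → ℂ⟦X⟧) ⧸ relations a) := by
  let χ : (ι → ℂ⟦X⟧) →ₗ[ℂ] ((i : ι) → Fin (a i) → ℂ) :=
    LinearMap.pi fun i => LinearMap.pi fun m => coeff (m : ℕ) ∘ₗ LinearMap.proj i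
  have hker : LinearMap.ker χ = (relations a).restrictScalars ℂ := by
    ext f
    rw [LinearMap.mem_ker, Submodule.restrictScalars_mem, mem_relations]
    simp only [X_pow_dvd_iff]
    constructor
    · exact fun h i m hm => congrFun (congrFun h i) ⟨m, hm⟩
    · exact fun h => funext fun i => funext fun m => h i m m.2
  have : FiniteDimensional ℂ ((ι → ℂ⟦X⟧) ⧸ LinearMap.ker χ) :=
    Module.Finite.equiv χ.quotKerEquivRange.symm
  exact Module.Finite.equiv ((Submodule.quotEquivOfEq _ _ hker).trans
    (Submodule.Quotient.restrictScalarsEquiv ℂ (relations a)))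

/-- The quotient of the free module by the relations realizes any given columns; it is lifted to the
universe `u`. -/
theorem exists_triple_hasColumns {ι : Type} [Finite ι] (a : ι → ℕ) (x y : ι → ℂ⟦X⟧) :
    ∃ A : InvTriple.{u}, HasColumns A a x y := by
  let Q := (ι → ℂ⟦X⟧) ⧸ relations a
  let e : ULift.{u} Q ≃ₗ[ℂ] Q := ULift.moduleEquiv
  have : FiniteDimensional ℂ (ULift.{u} Q) := Module.Finite.equiv e.symm
  let Φ : (ι → ℂ⟦X⟧) →ₗ[ℂ] ULift.{u} Q :=
    e.symm.toLinearMap ∘ₗ (relations a).mkQ.restrictScalars ℂ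
  let T : Module.End ℂ (ULift.{u} Q) :=
    e.symm.toLinearMap ∘ₗ ((LinearMap.lsmul ℂ⟦X⟧ Q X).restrictScalars ℂ) ∘ₗ e.toLinearMap
  have hT : ∀ f, Φ ((X : ℂ⟦X⟧) • f) = T (Φ f) := fun f => rfl
  let U : Submodule ℂ (ULift.{u} Q) :=
    ((Submodule.span ℂ⟦X⟧ {x, y}).restrictScalars ℂ).map Φ
  have hU : ∀ v ∈ U, T v ∈ U := by
    rintro _ ⟨f, hf, rfl⟩
    exact ⟨(X : ℂ⟦X⟧) • f, Submodule.smul_mem (Submodule.span ℂ⟦X⟧ {x, y}) X hf, hT f⟩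
  refine ⟨⟨ULift.{u} Q, T, U, hU⟩, Φ, ⟨?_, hT, fun f => ?_⟩, fun v => ?_⟩
  · exact e.symm.surjective.comp (relations a).mkQ_surjective
  · exact (e.symm.map_eq_zero_iff).trans (Submodule.Quotient.mk_eq_zero _)
  · constructor
    · rintro ⟨f, hf, rfl⟩
      obtain ⟨α, β, rfl⟩ := Submodule.mem_span_pair.1 hf
      exact ⟨α, β, rfl⟩
    · rintro ⟨α, β, rfl⟩
      exact ⟨_, Submodule.mem_span_pair.2 ⟨α, β, rfl⟩, rfl⟩

/-- Nakayama's lemma for a nilpotent operator. -/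
theorem surjective_of_range_sup_eq_top {V : Type v} {W : Type w} [AddCommGroup V] [Module ℂ V]
    [AddCommGroup W] [Module ℂ W] {S : Module.End ℂ V} {T : Module.End ℂ W} {f : V →ₗ[ℂ] W}
    {n : ℕ} (hT : T ^ n = 0) (hf : ∀ v, f (S v) = T (f v))
    (h : LinearMap.range f ⊔ LinearMap.range T = ⊤) : Function.Surjective f := by
  have hf' : ∀ k v, f ((S ^ k) v) = (T ^ k) (f v) := by
    intro k
    induction k with
    | zero => simp
    | succ k ih => intro v; rw [pow_succ, pow_succ, Module.End.mul_apply, ih, hf]; rfl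
  have h1 : ∀ w, ∃ v w', f v + T w' = w := by
    intro w
    obtain ⟨_, ⟨v, rfl⟩, _, ⟨w', rfl⟩, hw⟩ := Submodule.mem_sup.1 (h ▸ Submodule.mem_top (x := w))
    exact ⟨v, w', hw⟩
  have key : ∀ k w, ∃ v w', f v + (T ^ k) w' = w := by
    intro k
    induction k with
    | zero => exact fun w => ⟨0, w, by simp⟩
    | succ k ih =>
      intro w
      obtain ⟨v, w', rfl⟩ := ih w
      obtain ⟨v', w'', rfl⟩ := h1 w'
      exact ⟨v + (S ^ k) v', w'', by
        rw [map_add, map_add, hf', pow_succ, Module.End.mul_apply, add_assoc]⟩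
  intro w
  obtain ⟨v, w', hw⟩ := key n w
  exact ⟨v, by simpa [hT] using hw⟩

/-- The sizes of the Jordan blocks of `T` in the family: `q + 6`, `4`, `2`. -/
def familyParts (q : ℕ) : Fin 3 → ℕ := ![q + 6, 4, 2]

/-- The first generator of `U` in the family. -/
noncomputable def familyFst : Fin 3 → ℂ⟦X⟧ := ![X ^ 2, X, 1]

/-- The second generator of `U` in the family. -/
noncomputable def familySnd (z : ℂ) : Fin 3 → ℂ⟦X⟧ := ![0, X ^ 2, C z * X]

/-- The coefficient of `X ^ n` in `X ^ n * (f - g)` vanishes modulo `X ^ m` if `n < m`. -/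
theorem constantCoeff_eq_of_dvd {f g : ℂ⟦X⟧} {n m : ℕ} (hnm : n < m)
    (h : X ^ m ∣ X ^ n * (f - g)) : constantCoeff f = constantCoeff g := by
  have h1 := (pow_dvd_pow X hnm).trans h
  rw [pow_succ] at h1
  have h2 := X_dvd_iff.1 ((mul_dvd_mul_iff_left (pow_ne_zero n X_ne_zero)).1 h1)
  rwa [map_sub, sub_eq_zero] at h2

/-- The matrix of a morphism between two members of the family: `F j` are the coordinates of the
image of the `j`-th basis vector, `hF` says that the relations are respected, and the other
hypotheses say that the generators of `U` are mapped to `U`. Comparing the lowest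
coefficients, the matrix is lower triangular modulo `X` with a single eigenvalue `c`, which can only
be nonzero if the two parameters coincide. -/
theorem family_matrix {q : ℕ} {z z' : ℂ} {F : Fin 3 → Fin 3 → ℂ⟦X⟧}
    (hF : ∀ i j, X ^ familyParts q i ∣ X ^ familyParts q j * F j i)
    {α β γ δ : ℂ⟦X⟧}
    (h1 : ∀ i, X ^ familyParts q i ∣
      (α * familyFst i + β * familySnd z' i) - ∑ j, familyFst j * F j i)
    (h2 : ∀ i, X ^ familyParts q i ∣
      (γ * familyFst i + δ * familySnd z' i) - ∑ j, familySnd z j * F j i) :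
    ∃ c : ℂ, c * (z - z') = 0 ∧ (∀ j, constantCoeff (F j j) = c) ∧
      ∀ i j, i < j → constantCoeff (F j i) = 0 := by
  have hF10 := hF 0 1
  have hF20 := hF 0 2
  have hF21 := hF 1 2
  have h10 := h1 0
  have h11 := h1 1
  have h12 := h1 2
  have h20 := h2 0
  have h21 := h2 1
  have h22 := h2 2
  simp only [familyParts, familyFst, familySnd, Fin.sum_univ_three, Matrix.cons_val_zero,
    Matrix.cons_val_one, Matrix.cons_val] at *
  clear hF h1 h2
  obtain ⟨g10, e10⟩ := hF10
  obtain ⟨g20, e20⟩ := hF20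
  obtain ⟨g21, e21⟩ := hF21
  have hX : ∀ n, (X : ℂ⟦X⟧) ^ n ≠ 0 := fun n => pow_ne_zero n X_ne_zero
  have e10' : F 1 0 = X ^ 2 * (X ^ q * g10) :=
    mul_left_cancel₀ (hX 4) (by rw [e10]; ring)
  have e20' : F 2 0 = X ^ 4 * (X ^ q * g20) :=
    mul_left_cancel₀ (hX 2) (by rw [e20]; ring)
  have e21' : F 2 1 = X ^ 2 * g21 :=
    mul_left_cancel₀ (hX 2) (by rw [e21]; ring)
  obtain ⟨r0, hr0⟩ := h10
  obtain ⟨r1, hr1⟩ := h11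
  obtain ⟨r2, hr2⟩ := h12
  obtain ⟨s0, hs0⟩ := h20
  obtain ⟨s1, hs1⟩ := h21
  obtain ⟨s2, hs2⟩ := h22
  rw [e10', e20'] at hr0 hs0
  rw [e21'] at hr1 hs1
  -- the image of the second generator has first coordinate divisible by `X ^ 4`
  obtain ⟨g, hγ⟩ : ∃ g, γ = X ^ 2 * g :=
    ⟨X ^ q * g10 + C z * X ^ (q + 1) * g20 + X ^ (q + 2) * s0,
      mul_left_cancel₀ (hX 2) (by linear_combination hs0)⟩
  have c00 : constantCoeff α = constantCoeff (F 0 0) :=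
    constantCoeff_eq_of_dvd (n := 2) (m := 3) (by norm_num)
      ⟨X ^ q * g10 + X * X ^ q * g20 + X ^ (q + 3) * r0, by linear_combination hr0⟩
  have c11 : constantCoeff α = constantCoeff (F 1 1) :=
    constantCoeff_eq_of_dvd (n := 1) (m := 2) (by norm_num)
      ⟨F 0 1 + g21 - β + X ^ 2 * r1, by linear_combination hr1⟩
  have c22 : constantCoeff α = constantCoeff (F 2 2) :=
    constantCoeff_eq_of_dvd (n := 0) (m := 1) (by norm_num)
      ⟨X * F 0 2 + F 1 2 - β * C z' + X * r2, by linear_combination hr2⟩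
  have d11 : constantCoeff δ = constantCoeff (F 1 1) :=
    constantCoeff_eq_of_dvd (n := 2) (m := 3) (by norm_num)
      ⟨C z * g21 - g + X * s1, by
        rw [hγ] at hs1; linear_combination hs1⟩
  have d22 : constantCoeff (δ * C z') = constantCoeff (C z * F 2 2) :=
    constantCoeff_eq_of_dvd (n := 1) (m := 2) (by norm_num)
      ⟨F 1 2 - g + s2, by
        rw [hγ] at hs2; linear_combination hs2⟩
  refine ⟨constantCoeff α, ?_, fun j => ?_, fun i j hij => ?_⟩
  · rw [map_mul, map_mul, constantCoeff_C, constantCoeff_C, d11, ← c11, ← c22] at d22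
    linear_combination -d22
  · fin_cases j
    exacts [c00.symm, c11.symm, c22.symm]
  · fin_cases i <;> fin_cases j <;> simp_all

variable {A : InvTriple.{u}} {q : ℕ} {z : ℂ}

theorem familyParts_le (q : ℕ) (i : Fin 3) : familyParts q i ≤ q + 6 := by
  fin_cases i <;> simp [familyParts]

/-- A morphism between two members of the family has a single eigenvalue `c`, which vanishes if the
parameters differ. If `c = 0`, the morphism kills the socle `s` of the largest Jordan block; if
`c ≠ 0`, it is surjective. -/
theorem HasColumns.exists_eigenvalue (hA : HasColumns A (familyParts q) familyFst (familySnd z)) :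
    ∃ s : A.V, s ≠ 0 ∧ s ∈ LinearMap.range (A.T ^ (q + 5)) ∧
      ∀ {B : InvTriple.{u}} {z' : ℂ}, HasColumns B (familyParts q) familyFst (familySnd z') →
      ∀ f : A.V →ₗ[ℂ] B.V, (∀ v, f (A.T v) = B.T (f v)) → (∀ v ∈ A.U, f v ∈ B.U) →
        ∃ c : ℂ, c * (z - z') = 0 ∧ (c = 0 → f s = 0) ∧ (c ≠ 0 → Function.Surjective f) := by
  obtain ⟨Φ, hΦ, hUA⟩ := hA
  refine ⟨Φ ((X : ℂ⟦X⟧) ^ (q + 5) • Pi.single 0 1), fun h0 => ?_,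
    ⟨Φ (Pi.single 0 1), (hΦ.map_X_pow_smul _ _).symm⟩, ?_⟩
  · rw [hΦ.map_eq_zero, mem_relations] at h0
    have h := h0 0
    simp only [familyParts, Matrix.cons_val_zero, Pi.smul_apply, Pi.single_eq_same, smul_eq_mul,
      mul_one] at h
    have := (pow_dvd_pow_iff X_ne_zero (X_prime (R := ℂ)).not_isUnit).1 h
    omega
  rintro B z' ⟨Ψ, hΨ, hUB⟩ f hfT hfU
  have hBT : B.T ^ (q + 6) = 0 := hΨ.pow_eq_zero (familyParts_le q)
  choose F hFj using fun j => hΨ.surjective (f (Φ (Pi.single j 1)))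
  let g : (Fin 3 → ℂ⟦X⟧) →ₗ[ℂ⟦X⟧] (Fin 3 → ℂ⟦X⟧) :=
    ∑ j, (LinearMap.proj j).smulRight (F j)
  have hg : ∀ v, g v = ∑ j, v j • F j := fun v => by simp [g]
  have hgs : ∀ (j : Fin 3) (r : ℂ⟦X⟧), g (r • Pi.single j 1) = r • F j := by
    intro j r
    rw [hg, Finset.sum_eq_single j]
    · simp
    · intro k _ hk
      simp [Pi.single_eq_of_ne hk]
    · simp
  have key : ∀ v, f (Φ v) = Ψ (g v) := by
    have : f ∘ₗ Φ = Ψ ∘ₗ g.restrictScalars ℂ := by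
      refine linearMap_ext_of_nilpotent hBT (fun v => ?_) (fun v => ?_) fun j => ?_
      · simp [hΦ.map_X_smul, hfT]
      · simp [hΨ.map_X_smul]
      · have := hgs j 1
        rw [one_smul, one_smul] at this
        simp [this, hFj]
    exact LinearMap.congr_fun this
  have hF : ∀ i j, X ^ familyParts q i ∣ X ^ familyParts q j * F j i := by
    intro i j
    have h0 : Φ ((X : ℂ⟦X⟧) ^ familyParts q j • Pi.single j 1) = 0 := by
      rw [hΦ.map_eq_zero, mem_relations]
      intro k
      rcases eq_or_ne k j with rfl | hk
      · simp
      · simp [Pi.single_eq_of_ne hk]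
    have h1 := key ((X : ℂ⟦X⟧) ^ familyParts q j • Pi.single j 1)
    rw [h0, map_zero, hgs, eq_comm, hΨ.map_eq_zero, mem_relations] at h1
    exact h1 i
  have hgen : ∀ w : Fin 3 → ℂ⟦X⟧, Φ w ∈ A.U → ∃ α β : ℂ⟦X⟧, ∀ i, X ^ familyParts q i ∣
      (α * familyFst i + β * familySnd z' i) - ∑ j, w j * F j i := by
    intro w hw
    obtain ⟨α, β, h⟩ := (hUB _).1 (hfU _ hw)
    rw [key, hΨ.map_eq_iff] at h
    refine ⟨α, β, fun i => ?_⟩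
    simpa [hg] using h i
  obtain ⟨α, β, h1⟩ := hgen familyFst ((hUA _).2 ⟨1, 0, by simp⟩)
  obtain ⟨γ, δ, h2⟩ := hgen (familySnd z) ((hUA _).2 ⟨0, 1, by simp⟩)
  obtain ⟨c, hc, hdiag, hupper⟩ := family_matrix hF h1 h2
  refine ⟨c, hc, fun h0 => ?_, fun h0 => ?_⟩
  · rw [key, hgs, hΨ.map_eq_zero, mem_relations]
    intro i
    by_cases hi : i = 0
    · obtain ⟨r, hr⟩ := X_dvd_iff.2 ((hdiag 0).trans h0)
      rw [hi, Pi.smul_apply, smul_eq_mul, hr]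
      exact ⟨r, by simp only [familyParts, Matrix.cons_val_zero]; ring⟩
    · refine (pow_dvd_pow X ?_).mul_right _
      fin_cases i
      · exact absurd rfl hi
      · simp [familyParts]
      · simp [familyParts]
  · refine surjective_of_range_sup_eq_top hBT hfT ?_
    set S := LinearMap.range f ⊔ LinearMap.range B.T
    have hSX : ∀ w : Fin 3 → ℂ⟦X⟧, (∀ i, constantCoeff (w i) = 0) → Ψ w ∈ S := by
      intro w hw
      choose r hr using fun i => X_dvd_iff.2 (hw i)
      have : w = (X : ℂ⟦X⟧) • r := funext hr
      rw [this, hΨ.map_X_smul]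
      exact Submodule.mem_sup_right ⟨_, rfl⟩
    -- only the constant coefficients of the coordinates matter modulo the range of `T`
    have hSC : ∀ w : Fin 3 → ℂ⟦X⟧, Ψ w - ∑ i, constantCoeff (w i) • Ψ (Pi.single i 1) ∈ S := by
      intro w
      have := hSX (w - ∑ i, constantCoeff (w i) • (Pi.single i 1 : Fin 3 → ℂ⟦X⟧)) fun i => by
        rw [Pi.sub_apply, Finset.sum_apply, Finset.sum_eq_single i]
        · simp [PowerSeries.smul_eq_C_mul]
        · intro k _ hk
          simp [Pi.single_eq_of_ne hk.symm]
        · simp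
      simpa only [map_sub, map_sum, map_smul] using this
    have hcol : ∀ j, ∑ i, constantCoeff (F j i) • Ψ (Pi.single i 1) ∈ S := by
      intro j
      have h3 : Ψ (F j) ∈ S := by
        rw [hFj]
        exact Submodule.mem_sup_left ⟨_, rfl⟩
      simpa using S.sub_mem h3 (hSC (F j))
    have hcol0 := hcol 0
    have hcol1 := hcol 1
    have hcol2 := hcol 2
    simp only [Fin.sum_univ_three, hdiag, hupper 0 1 (by decide), hupper 0 2 (by decide),
      hupper 1 2 (by decide), zero_smul, zero_add] at hcol0 hcol1 hcol2
    have e2 : Ψ (Pi.single 2 1) ∈ S := (S.smul_mem_iff h0).1 hcol2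
    have e1 : Ψ (Pi.single 1 1) ∈ S :=
      (S.smul_mem_iff h0).1 ((S.add_mem_iff_left (S.smul_mem _ e2)).1 hcol1)
    have e0 : Ψ (Pi.single 0 1) ∈ S :=
      (S.smul_mem_iff h0).1 ((S.add_mem_iff_left (S.smul_mem _ e1)).1
        ((S.add_mem_iff_left (S.smul_mem _ e2)).1 hcol0))
    rw [eq_top_iff]
    intro v _
    obtain ⟨w, rfl⟩ := hΨ.surjective v
    have h4 : ∑ i, constantCoeff (w i) • Ψ (Pi.single i 1) ∈ S := by
      rw [Fin.sum_univ_three]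
      exact S.add_mem (S.add_mem (S.smul_mem _ e0) (S.smul_mem _ e1)) (S.smul_mem _ e2)
    simpa using S.add_mem (hSC w) h4

theorem HasColumns.family_hasOrder (hA : HasColumns A (familyParts q) familyFst (familySnd z)) :
    A.HasOrder (q + 6) := by
  obtain ⟨s, hs, ⟨v, rfl⟩, -⟩ := hA.exists_eigenvalue
  obtain ⟨Φ, hΦ, -⟩ := hA
  refine ⟨by omega, hΦ.pow_eq_zero (familyParts_le q), fun h0 => hs ?_⟩
  rw [show q + 6 - 1 = q + 5 by omega] at h0
  rw [h0, LinearMap.zero_apply]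

theorem HasColumns.family_nV (hA : HasColumns A (familyParts q) familyFst (familySnd z)) :
    A.nV = 3 := by
  obtain ⟨Φ, hΦ, -⟩ := hA
  refine hΦ.finrank_ker fun i => ?_
  fin_cases i <;> simp [familyParts]

/-- The two generators of `U` are independent, with annihilators `X ^ (q + 4)` and `X ^ 2`. -/
theorem HasColumns.family_nU (hA : HasColumns A (familyParts q) familyFst (familySnd z)) :
    A.nU = 2 := by
  obtain ⟨Φ, hΦ, hU⟩ := hA
  let g : (Fin 2 → ℂ⟦X⟧) →ₗ[ℂ⟦X⟧] (Fin 3 → ℂ⟦X⟧) :=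
    (LinearMap.proj 0).smulRight familyFst + (LinearMap.proj 1).smulRight (familySnd z)
  have hg : ∀ f, g f = f 0 • familyFst + f 1 • familySnd z := fun f => rfl
  let Ψ : (Fin 2 → ℂ⟦X⟧) →ₗ[ℂ] A.U :=
    (Φ ∘ₗ g.restrictScalars ℂ).codRestrict A.U fun f => (hU _).2 ⟨f 0, f 1, rfl⟩
  have hΨ : ∀ f, (Ψ f : A.V) = Φ (g f) := fun f => rfl
  have hpres : IsPresentation Ψ (A.T.restrict A.invariant) ![q + 4, 2] := by
    refine ⟨fun v => ?_, fun f => ?_, fun f => ?_⟩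
    · obtain ⟨α, β, h⟩ := (hU _).1 v.2
      exact ⟨![α, β], Subtype.ext h⟩
    · apply Subtype.ext
      rw [hΨ, map_smul, hΦ.map_X_smul]
      rfl
    · rw [← Submodule.coe_eq_zero, hΨ, hΦ.map_eq_zero, mem_relations, mem_relations, hg]
      simp only [Fin.forall_fin_succ, IsEmpty.forall_iff, and_true, familyParts, familyFst,
        familySnd, Pi.add_apply, Pi.smul_apply, smul_eq_mul, Matrix.cons_val_zero,
        Matrix.cons_val_succ, mul_zero, add_zero, mul_one]
      have hX : ∀ n, (X : ℂ⟦X⟧) ^ n ≠ 0 := fun n => pow_ne_zero n X_ne_zero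
      constructor
      · rintro ⟨⟨r, hr⟩, ⟨s, hs⟩, -⟩
        have h0 : f 0 = X ^ (q + 4) * r :=
          mul_left_cancel₀ (hX 2) (by linear_combination hr)
        refine ⟨⟨r, h0⟩, ⟨s - X ^ (q + 1) * r, mul_left_cancel₀ (hX 2) ?_⟩⟩
        rw [h0] at hs
        change X ^ 2 * f 1 = X ^ 2 * (X ^ 2 * (s - X ^ (q + 1) * r))
        linear_combination hs
      · rintro ⟨⟨r, hr⟩, ⟨s, hs⟩⟩
        replace hs : f 1 = X ^ 2 * s := hs
        rw [hr]
        refine ⟨⟨r, by ring⟩, ⟨X ^ (q + 1) * r + s, ?_⟩, ⟨X ^ (q + 2) * r + s * C z * X, ?_⟩⟩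
        · linear_combination X ^ 2 * hs
        · linear_combination (C z * X) * hs
  exact hpres.finrank_ker fun i => by fin_cases i <;> simp

/-- The projections of a decomposition `V = V' ⊕ V''` are endomorphisms of the triple. They cannot
both have eigenvalue `0`, and a surjective projection is the identity. -/
theorem HasColumns.family_indecomposable
    (hA : HasColumns A (familyParts q) familyFst (familySnd z)) : A.Indecomposable := by
  intro V' V'' h' h'' hV hU
  obtain ⟨s, hs, -, H⟩ := hA.exists_eigenvalue
  have main : ∀ V' V'' : Submodule ℂ A.V, (∀ x ∈ V', A.T x ∈ V') → (∀ x ∈ V'', A.T x ∈ V'') →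
      ∀ hV : IsCompl V' V'', A.U = (A.U ⊓ V') ⊔ (A.U ⊓ V'') →
        V'.projection V'' hV s = 0 ∨ V'' = ⊥ := by
    intro V' V'' h' h'' hV hU
    have hproj : ∀ v ∈ V', ∀ w ∈ V'', V'.projection V'' hV (v + w) = v := by
      intro v hv w hw
      rw [map_add, Submodule.projection_apply_of_mem_left hV hv,
        Submodule.projection_apply_of_mem_right hV hw, add_zero]
    obtain ⟨c, -, h0, h1⟩ := H hA (V'.projection V'' hV) (fun x => by
      obtain ⟨v, hv, w, hw, rfl⟩ := Submodule.mem_sup.1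
        (hV.sup_eq_top ▸ Submodule.mem_top (x := x))
      rw [map_add, hproj _ (h' _ hv) _ (h'' _ hw), hproj _ hv _ hw]) (fun x hx => by
      rw [hU] at hx
      obtain ⟨v, hv, w, hw, rfl⟩ := Submodule.mem_sup.1 hx
      rw [hproj _ hv.2 _ hw.2]
      exact hv.1)
    by_cases hc : c = 0
    · exact Or.inl (h0 hc)
    · right
      have := LinearMap.range_eq_top.2 (h1 hc)
      rw [Submodule.range_projection] at this
      rw [this] at hV
      exact hV.symm.disjoint.eq_bot_of_le le_top
  rcases main V' V'' h' h'' hV hU with h1 | h1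
  · rcases main V'' V' h'' h' hV.symm (by rw [sup_comm]; exact hU) with h2 | h2
    · rw [Submodule.projection_apply_eq_zero_iff] at h1 h2
      exact absurd (Submodule.disjoint_def.1 hV.disjoint s h2 h1) hs
    · exact Or.inl h2
  · exact Or.inr h1

theorem HasColumns.family_eq_of_similar {B : InvTriple.{u}} {z' : ℂ}
    (hA : HasColumns A (familyParts q) familyFst (familySnd z))
    (hB : HasColumns B (familyParts q) familyFst (familySnd z')) (h : Similar A B) : z = z' := by
  obtain ⟨s, hs, -, H⟩ := hA.exists_eigenvalue
  obtain ⟨f, hT, hU⟩ := h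
  obtain ⟨c, hc, h0, -⟩ := H hB f.toLinearMap hT fun v hv => hU ▸ Submodule.mem_map_of_mem hv
  have hc0 : c ≠ 0 := fun h => hs (f.map_eq_zero_iff.1 (h0 h))
  exact sub_eq_zero.1 ((mul_eq_zero.1 hc).resolve_left hc0)

theorem exists_family {p : ℕ} (hp : 6 ≤ p) : ∃ F : ℂ → Quotient similarSetoid.{u},
    Function.Injective F ∧ ∀ z, F z ∈ indecClasses.{u} p 3 2 := by
  obtain ⟨q, rfl⟩ := Nat.exists_eq_add_of_le' hp
  choose A hA using fun z =>
    exists_triple_hasColumns.{u} (familyParts q) familyFst (familySnd z)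
  refine ⟨fun z => Quotient.mk _ (A z), fun z z' h => ?_, fun z => ⟨A z, rfl, ?_⟩⟩
  · exact (hA z).family_eq_of_similar (hA z') (Quotient.exact h)
  · exact ⟨(hA z).family_hasOrder, (hA z).family_nV, (hA z).family_nU,
      (hA z).family_indecomposable⟩

end Family

end InvTriple

theorem mainTheorem5 (p : ℕ) (hp : 1 ≤ p) :
    ((InvTriple.indecClasses.{u} p 3 2).Infinite ↔ 6 ≤ p) ∧
    (6 ≤ p → ∃ F : ℂ → Quotient InvTriple.similarSetoid.{u},
      Function.Injective F ∧ ∀ z, F z ∈ InvTriple.indecClasses.{u} p 3 2) := by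
  refine ⟨⟨fun h => ?_, fun h => ?_⟩, InvTriple.exists_family⟩
  · by_contra hlt
    exact h (InvTriple.finite_indecClasses (by omega))
  · obtain ⟨F, hF, hmem⟩ := InvTriple.exists_family h
    exact (Set.infinite_range_of_injective hF).mono (Set.range_subset_iff.2 hmem)
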